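/- A $(4,6)$-fullerene is a finite simple $3$-connected planar graph (a polyhedral graph) that is cubic, i.e. every vertex has degree $3$, embedded in the plane (equivalently, in the sphere) so that every face that is not a hexagon is a quadrilateral ("square"); the unbounded face counts as a face. Two distinct faces are adjacent if they share an edge. **Corollary 1.** Every $(4,6)$-fullerene is face $3$-colorable: its faces can be colored with three colors so that any two adjacent faces have different colors. -/

import Mathlib

namespace SimpleGraph

/-- A graph is 3-(vertex-)connected if it has more than three vertices and stays connected
after the removal of any set of fewer than three vertices. -/
def IsThreeConnected {V : Type*} (G : SimpleGraph V) : Prop :=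
  3 < Nat.card V ∧ ∀ S : Finset V, S.card < 3 → (G.induce {v : V | v ∉ S}).Connected

/-- An embedding of a graph into the oriented sphere (equivalently, into the plane), up to
isotopy, presented as a combinatorial map: a permutation `rot` of the darts (oriented edges) such
that the cycles of `rot` are exactly the sets of darts leaving a vertex (`rot d` is the dart that
follows `d` in counterclockwise order around the vertex `d.fst`), and such that the resulting
closed surface is a sphere, that is, has Euler characteristic `2`. The faces are the cycles
of the permutation `d ↦ rot d.symm`, which sends a dart to the next one on the boundary of the
face on a fixed side of it. -/
structure PlaneEmbedding {V : Type*} (G : SimpleGraph V) where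
  /-- The rotation of the darts around the vertex they leave. -/
  rot : Equiv.Perm G.Dart
  /-- The darts leaving a common vertex form one cycle of the rotation. -/
  rot_sameCycle : ∀ d e : G.Dart, rot.SameCycle d e ↔ d.fst = e.fst
  /-- The underlying graph of a connected surface is connected. -/
  connected : G.Connected
  /-- Euler's formula `|V| - |E| + |F| = 2`. -/
  euler : (Nat.card V : ℤ) - Nat.card G.edgeSet +
    Nat.card (Quotient (Equiv.Perm.SameCycle.setoid
      ((Function.Involutive.toPerm Dart.symm Dart.symm_involutive).trans rot))) = 2

namespace PlaneEmbedding

variable {V : Type*} {G : SimpleGraph V}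

/-- The permutation `d ↦ rot d.symm` of the darts, which walks around the faces. -/
def facePerm (M : G.PlaneEmbedding) : Equiv.Perm G.Dart :=
  (Function.Involutive.toPerm Dart.symm Dart.symm_involutive).trans M.rot

/-- The faces of a plane embedding: the cycles of the face permutation. -/
def Face (M : G.PlaneEmbedding) : Type _ :=
  Quotient (Equiv.Perm.SameCycle.setoid M.facePerm)

/-- The face that has the dart `d` on its boundary walk. The two faces on the two sides of the
edge of `d` are `M.face d` and `M.face d.symm`. -/
def face (M : G.PlaneEmbedding) (d : G.Dart) : M.Face :=
  Quotient.mk (Equiv.Perm.SameCycle.setoid M.facePerm) d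

/-- The size of a face: the length of its boundary walk. -/
noncomputable def faceSize (M : G.PlaneEmbedding) (f : M.Face) : ℕ :=
  {d : G.Dart | M.face d = f}.ncard

/-- The adjacency graph of the faces: two distinct faces are adjacent if there is an edge which
has one of them on one side and the other one on the other side. -/
def faceGraph (M : G.PlaneEmbedding) : SimpleGraph M.Face where
  Adj f g := f ≠ g ∧ ∃ d : G.Dart, M.face d = f ∧ M.face d.symm = g
  symm := ⟨by
    rintro f g ⟨hne, d, rfl, rfl⟩
    exact ⟨hne.symm, d.symm, rfl, by rw [Dart.symm_symm]⟩⟩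
  loopless := ⟨fun _ h => h.1 rfl⟩

/-- Face `k`-colorability: the faces can be colored with `k` colors so that adjacent faces
have different colors. -/
def FaceColorable (M : G.PlaneEmbedding) (k : ℕ) : Prop :=
  M.faceGraph.Colorable k

/-- A `(4,6)`-fullerene: a finite graph embedded in the plane which is polyhedral (3-connected)
and cubic, and whose faces are all quadrilaterals or hexagons. -/
structure IsFourSixFullerene [Fintype V] [DecidableRel G.Adj] (M : G.PlaneEmbedding) : Prop where
  threeConnected : G.IsThreeConnected
  cubic : G.IsRegularOfDegree 3
  faceSize_eq : ∀ f : M.Face, M.faceSize f ≠ 6 → M.faceSize f = 4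

end PlaneEmbedding

end SimpleGraph

/-! Even faces make the graph bipartite. Give each dart the value `1` or `-1` in `ZMod 3` according
to the color of its tail. This is antisymmetric, and its sum at each cubic vertex is `3 * (±1) = 0`.
The first cohomology of the sphere vanishes (`exists_potential`, applied to the dual map), so the
values are differences of a function on faces. Adjacent faces differ by `±1`, so this function is a
proper 3-coloring. Bipartiteness comes from the same theorem over `ZMod 2`. -/

namespace Submodule

/-- A space of functions all of which are constant has dimension at most one. -/
lemma finrank_le_one_of_forall_const {k X : Type*} [Field k] [Finite X]
    (W : Submodule k (X → k)) (h : ∀ g ∈ W, ∀ x y, g x = g y) : Module.finrank k W ≤ 1 := by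
  have hle : W ≤ span k {fun _ => (1 : k)} := by
    intro g hg
    rw [mem_span_singleton]
    rcases isEmpty_or_nonempty X with hX | ⟨⟨x⟩⟩
    · exact ⟨0, Subsingleton.elim _ _⟩
    · exact ⟨g x, funext fun y => by simp [h g hg x y]⟩
  refine (finrank_mono hle).trans ?_
  simpa using finrank_span_le_card (R := k) ({fun _ => (1 : k)} : Set (X → k))

end Submodule

/-! ### Vanishing cohomology by a dimension count -/

namespace CombinatorialMap

open Module

variable {k D V E F : Type*} [Field k]

/-- The functions on darts that change sign when a dart is reversed. -/
def antisymmetric (k : Type*) [Field k] {D : Type*} (s : D → D) : Submodule k (D → k) where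
  carrier := {c | ∀ d, c (s d) = -c d}
  add_mem' := by
    intro a b ha hb d
    simp only [Pi.add_apply, ha d, hb d]
    ring
  zero_mem' := by intro d; simp
  smul_mem' := by
    intro r a ha d
    simp [ha d]

lemma finrank_antisymmetric_le [Finite D] [Finite E] (s : D → D) (e : D → E)
    (he : ∀ x, ∃ d, e d = x) (hes : ∀ d d', e d = e d' → d' = d ∨ d' = s d) :
    finrank k (antisymmetric k s) ≤ Nat.card E := by
  have := Fintype.ofFinite E
  choose o ho using he
  let R : antisymmetric k s →ₗ[k] (E → k) :=
    (LinearMap.funLeft k k o).comp (antisymmetric k s).subtype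
  have hR : Function.Injective R := by
    rw [← LinearMap.ker_eq_bot, LinearMap.ker_eq_bot']
    intro c hc
    ext d
    have h0 : c.1 (o (e d)) = 0 := congrFun hc (e d)
    rcases hes _ _ (ho (e d)) with h | h
    · simpa [← h] using h0
    · have := c.2 (o (e d))
      rw [← h, h0, neg_zero] at this
      simpa using this
  simpa [Nat.card_eq_fintype_card] using LinearMap.finrank_le_finrank_of_injective hR

/-- The coboundary of a function on vertices. -/
def coboundary (k : Type*) [Field k] (s : D → D) (hs : Function.Involutive s) (v : D → V) :
    (V → k) →ₗ[k] antisymmetric k s where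
  toFun φ := ⟨fun d => φ (v (s d)) - φ (v d), fun d => by simp [hs d]⟩
  map_add' a b := by
    ext d
    simp only [Pi.add_apply, Submodule.coe_add]
    ring
  map_smul' r a := by
    ext d
    simp [mul_sub]

open Classical in
/-- The sums of an antisymmetric function on darts over the face boundaries. -/
noncomputable def circulation (k : Type*) [Field k] [Fintype D] (s : D → D) (f : D → F) :
    antisymmetric k s →ₗ[k] (F → k) where
  toFun c x := ∑ d with f d = x, c.1 d
  map_add' a b := by
    ext x
    simp [Finset.sum_add_distrib]
  map_smul' r a := by
    ext x
    simp [Finset.mul_sum]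

/-- A functional killing the range takes equal values on the two faces beside each edge, so it is
constant by `hF`; the corank is at most one. -/
lemma card_le_finrank_range_circulation_add_one [Fintype D] [Finite F] (s : D → D)
    (hs : Function.Involutive s) (f : D → F)
    (hF : ∀ g : F → k, (∀ d, g (f d) = g (f (s d))) → ∀ x y, g x = g y) :
    Nat.card F ≤ finrank k (circulation k s f).range + 1 := by
  classical
  have := Fintype.ofFinite F
  let A : Submodule k (Dual k (F → k)) := (circulation k s f).range.dualAnnihilator
  let T : Dual k (F → k) ≃ₗ[k] (F → k) := ((Pi.basisFun k F).constr k).symm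
  have hT : ∀ ψ x, T ψ x = ψ (Pi.single x 1) := by
    intro ψ x
    simp [T, Basis.constr]
  have hA : finrank k (A.map T.toLinearMap) ≤ 1 := by
    apply Submodule.finrank_le_one_of_forall_const
    rintro _ ⟨ψ, hψ, rfl⟩
    apply hF
    intro d
    let c : antisymmetric k s := ⟨Pi.single d 1 - Pi.single (s d) 1, fun d' => by
      have h1 : s d' = d ↔ d' = s d := ⟨fun h => by rw [← h, hs], fun h => by rw [h, hs]⟩
      simp only [Pi.sub_apply, Pi.single_apply, hs.injective.eq_iff, h1, neg_sub]⟩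
    have hc : circulation k s f c = Pi.single (f d) 1 - Pi.single (f (s d)) 1 := by
      ext x
      simp [circulation, c, Finset.sum_sub_distrib, Pi.single_apply, Finset.sum_ite_eq',
        eq_comm]
    have h0 : ψ (circulation k s f c) = 0 :=
      (Submodule.mem_dualAnnihilator ψ).1 hψ _ ⟨c, rfl⟩
    rw [hc, map_sub, sub_eq_zero] at h0
    simpa [hT] using h0
  rw [LinearEquiv.finrank_map_eq] at hA
  have hsum := Subspace.finrank_add_finrank_dualAnnihilator_eq (circulation k s f).range
  rw [finrank_fintype_fun_eq_card, ← Nat.card_eq_fintype_card] at hsum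
  change finrank k (circulation k s f).range.dualAnnihilator ≤ 1 at hA
  omega

/-- The first cohomology of a combinatorial sphere vanishes: an antisymmetric function on darts
whose sum around every face is zero is a coboundary. -/
theorem exists_potential [Fintype D] [Finite V] [Finite E] [Finite F] (s : D → D)
    (hs : Function.Involutive s) (p : Equiv.Perm D) (v : D → V) (e : D → E) (f : D → F)
    (hfp : ∀ d, f (p d) = f d) (hvp : ∀ d, v (p d) = v (s d))
    (he : ∀ x, ∃ d, e d = x) (hes : ∀ d d', e d = e d' → d' = d ∨ d' = s d)
    (hV : ∀ g : V → k, (∀ d, g (v d) = g (v (s d))) → ∀ x y, g x = g y)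
    (hF : ∀ g : F → k, (∀ d, g (f d) = g (f (s d))) → ∀ x y, g x = g y)
    (euler : (Nat.card V : ℤ) - Nat.card E + Nat.card F = 2)
    (c : D → k) (hc : ∀ d, c (s d) = -c d)
    (hcf : ∀ x, circulation k s f ⟨c, hc⟩ x = 0) :
    ∃ φ : V → k, ∀ d, c d = φ (v (s d)) - φ (v d) := by
  classical
  have := Fintype.ofFinite V
  have hle : (coboundary k s hs v).range ≤ (circulation k s f).ker := by
    rintro _ ⟨φ, rfl⟩
    rw [LinearMap.mem_ker]
    ext x
    simp only [circulation, coboundary, LinearMap.coe_mk, AddHom.coe_mk, Finset.sum_sub_distrib,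
      Pi.zero_apply, sub_eq_zero]
    -- The sum telescopes: the head of `d` is the tail of `p d`, and `p` permutes the darts of each
    -- face.
    refine Finset.sum_equiv p (by simp [hfp]) (by simp [hvp])
  have h1 := finrank_antisymmetric_le (k := k) s e he hes
  have h2 := card_le_finrank_range_circulation_add_one s hs f hF
  have h3 := (circulation k s f).finrank_range_add_finrank_ker
  have h4 := (coboundary k s hs v).finrank_range_add_finrank_ker
  have h5 : finrank k (coboundary k s hs v).ker ≤ 1 := by
    apply Submodule.finrank_le_one_of_forall_const
    intro g hg
    apply hV
    intro d
    have := congrFun (congrArg Subtype.val (LinearMap.mem_ker.1 hg)) d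
    exact (sub_eq_zero.1 this).symm
  rw [finrank_fintype_fun_eq_card, ← Nat.card_eq_fintype_card] at h4
  -- The range has dimension at least `|V| - 1`, the kernel at most `|E| - |F| + 1`; these bounds
  -- agree by Euler's formula.
  have heq := Submodule.eq_of_le_of_finrank_le hle (by omega)
  have hmem : (⟨c, hc⟩ : antisymmetric k s) ∈ (coboundary k s hs v).range := by
    rw [heq, LinearMap.mem_ker]
    exact funext hcf
  obtain ⟨φ, hφ⟩ := hmem
  exact ⟨φ, fun d => (congrFun (congrArg Subtype.val hφ) d).symm⟩

end CombinatorialMap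

/-! ### Potentials and colorings of plane graphs -/

namespace SimpleGraph.PlaneEmbedding

variable {V : Type*} {G : SimpleGraph V} (M : G.PlaneEmbedding)

lemma facePerm_apply (d : G.Dart) : M.facePerm d = M.rot d.symm := rfl

lemma fst_rot (d : G.Dart) : (M.rot d).fst = d.fst :=
  (M.rot_sameCycle _ _).1 (Equiv.Perm.sameCycle_apply_left.2 (Equiv.Perm.SameCycle.refl _ _))

lemma face_facePerm (d : G.Dart) : M.face (M.facePerm d) = M.face d :=
  Quotient.sound (Equiv.Perm.sameCycle_apply_left.2 (Equiv.Perm.SameCycle.refl _ _))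

lemma face_rot (d : G.Dart) : M.face (M.rot d) = M.face d.symm := by
  simpa [facePerm_apply] using M.face_facePerm d.symm

lemma face_surjective : Function.Surjective M.face := Quotient.mk_surjective

instance [Finite G.Dart] : Finite M.Face := Quotient.finite _

lemma eq_of_forall_dart {α : Type*} (hG : G.Connected) (g : V → α)
    (h : ∀ d : G.Dart, g d.fst = g d.symm.fst) (x y : V) : g x = g y := by
  obtain ⟨w⟩ := hG.preconnected x y
  induction w with
  | nil => rfl
  | cons hadj _ ih => exact (h ⟨(_, _), hadj⟩).trans ih

/-- The dual graph is connected: each rotation step about a vertex crosses one edge, and a walk in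
`G` links the vertices. -/
lemma eq_of_forall_face {α : Type*} (g : M.Face → α)
    (h : ∀ d, g (M.face d) = g (M.face d.symm)) (x y : M.Face) : g x = g y := by
  have hrot : ∀ d e : G.Dart, d.fst = e.fst → g (M.face d) = g (M.face e) := by
    intro d e hde
    obtain ⟨n, rfl⟩ := (M.rot_sameCycle d e).2 hde
    have step : ∀ d, g (M.face (M.rot d)) = g (M.face d) := fun d => by rw [face_rot, ← h]
    induction n using Int.induction_on with
    | zero => rfl
    | succ n ih =>
      rw [add_comm, zpow_add, zpow_one, Equiv.Perm.mul_apply, step]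
      exact ih ((M.rot_sameCycle _ _).1 ⟨n, rfl⟩)
    | pred n ih =>
      rw [ih ((M.rot_sameCycle _ _).1 ⟨_, rfl⟩), ← step ((M.rot ^ (-(n : ℤ) - 1)) d),
        ← Equiv.Perm.mul_apply, ← zpow_one_add]
      congr 4
      ring
  obtain ⟨d, rfl⟩ := M.face_surjective x
  obtain ⟨e, rfl⟩ := M.face_surjective y
  obtain ⟨w⟩ := M.connected.preconnected d.fst e.fst
  generalize ha : d.fst = a at w
  generalize hb : e.fst = b at w
  induction w generalizing d with
  | nil => exact hrot d e (ha.trans hb.symm)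
  | cons hadj _ ih =>
    rw [hrot d ⟨(_, _), hadj⟩ ha, h]
    exact ih _ rfl hb

lemma exists_dart_edge_eq (x : G.edgeSet) :
    ∃ d : G.Dart, (⟨d.edge, d.edge_mem⟩ : G.edgeSet) = x := by
  obtain ⟨⟨a, b⟩, hx⟩ := x
  exact ⟨⟨(a, b), hx⟩, rfl⟩

lemma eq_or_eq_symm_of_edge_eq (d d' : G.Dart)
    (h : (⟨d.edge, d.edge_mem⟩ : G.edgeSet) = ⟨d'.edge, d'.edge_mem⟩) :
    d' = d ∨ d' = d.symm :=
  (dart_edge_eq_iff d' d).1 (Subtype.ext_iff.1 h).symm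

open Classical in
/-- An antisymmetric function on darts with zero sum around every face is the coboundary of a
function on vertices. -/
theorem exists_vertex_potential {k : Type*} [Field k] [Finite V] [Fintype G.Dart] (c : G.Dart → k)
    (hc : ∀ d, c d.symm = -c d) (hcf : ∀ x, ∑ d with M.face d = x, c d = 0) :
    ∃ φ : V → k, ∀ d : G.Dart, c d = φ d.snd - φ d.fst :=
  CombinatorialMap.exists_potential Dart.symm Dart.symm_involutive M.facePerm (fun d => d.fst)
    (fun d => (⟨d.edge, d.edge_mem⟩ : G.edgeSet)) M.face M.face_facePerm
    (fun d => M.fst_rot d.symm) exists_dart_edge_eq eq_or_eq_symm_of_edge_eq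
    (eq_of_forall_dart M.connected) M.eq_of_forall_face M.euler c hc hcf

open Classical in
/-- An antisymmetric function on darts with zero sum around every vertex is the coboundary of a
function on faces. -/
theorem exists_face_potential {k : Type*} [Field k] [Finite V] [Fintype G.Dart] (c : G.Dart → k)
    (hc : ∀ d, c d.symm = -c d) (hcv : ∀ x, ∑ d : G.Dart with d.fst = x, c d = 0) :
    ∃ φ : M.Face → k, ∀ d : G.Dart, c d = φ (M.face d.symm) - φ (M.face d) :=
  -- Duality: `rot` acts as the face permutation, with vertices and faces exchanged.
  CombinatorialMap.exists_potential Dart.symm Dart.symm_involutive M.rot M.face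
    (fun d => (⟨d.edge, d.edge_mem⟩ : G.edgeSet)) (fun d => d.fst) M.fst_rot M.face_rot
    exists_dart_edge_eq eq_or_eq_symm_of_edge_eq M.eq_of_forall_face
    (eq_of_forall_dart M.connected)
    (by have h : (Nat.card V : ℤ) - Nat.card G.edgeSet + Nat.card M.Face = 2 := M.euler
        linarith) c hc hcv

/-- A plane graph all of whose faces have even size has a proper 2-coloring of its vertices. -/
theorem exists_two_coloring [Finite V] (hM : ∀ f, Even (M.faceSize f)) :
    ∃ φ : V → ZMod 2, ∀ d : G.Dart, φ d.snd = φ d.fst + 1 := by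
  classical
  have := Fintype.ofFinite V
  -- The constant `1` is antisymmetric in characteristic two, and its sum around a face is the face
  -- size mod 2.
  obtain ⟨φ, hφ⟩ := M.exists_vertex_potential (k := ZMod 2) (fun _ => 1) (fun _ => by decide) (by
    intro x
    have h : ((Finset.univ.filter fun d => M.face d = x).card : ZMod 2) = 0 := by
      rw [ZMod.natCast_eq_zero_iff_even, ← Set.ncard_coe_finset]
      simpa [faceSize] using hM x
    simpa using h)
  exact ⟨φ, fun d => by rw [hφ d]; ring⟩

/-- A cubic plane graph all of whose faces have even size is face 3-colorable. -/
theorem faceColorable_three [Fintype V] [DecidableRel G.Adj] (hG : G.IsRegularOfDegree 3)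
    (hM : ∀ f, Even (M.faceSize f)) : M.FaceColorable 3 := by
  classical
  obtain ⟨φ, hφ⟩ := M.exists_two_coloring hM
  let σ : ZMod 2 → ZMod 3 := fun a => if a = 0 then 1 else -1
  have hσ : ∀ a, σ (a + 1) = -σ a := by decide
  have hσ0 : ∀ a, σ a ≠ 0 := by decide
  obtain ⟨ψ, hψ⟩ := M.exists_face_potential (k := ZMod 3) (fun d => σ (φ d.fst))
    (fun d => (congrArg σ (hφ d)).trans (hσ _)) (by
      intro x
      have hcard : (Finset.univ.filter fun d : G.Dart => d.fst = x).card = 3 :=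
        (G.dart_fst_fiber_card_eq_degree x).trans (hG x)
      rw [Finset.sum_congr rfl (g := fun _ => σ (φ x)) (fun d hd => by
        rw [(Finset.mem_filter.1 hd).2]), Finset.sum_const, hcard]
      generalize σ (φ x) = a
      revert a
      decide)
  -- `ZMod 3` unfolds to `Fin 3`, so `ψ` itself is the coloring.
  refine ⟨Coloring.mk (G := M.faceGraph) (α := Fin 3) ψ ?_⟩
  rintro _ _ ⟨-, d, rfl, rfl⟩ h
  refine hσ0 (φ d.fst) ((hψ d).trans ?_)
  exact sub_eq_zero.2 h.symm

end SimpleGraph.PlaneEmbedding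

theorem corollary1 {V : Type*} [Fintype V] (G : SimpleGraph V) [DecidableRel G.Adj]
    (M : G.PlaneEmbedding) (hM : M.IsFourSixFullerene) :
    M.FaceColorable 3 := by
  refine M.faceColorable_three hM.cubic fun f => ?_
  by_cases h : M.faceSize f = 6
  · rw [h]; decide
  · rw [hM.faceSize_eq f h]; decide
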